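/- Consider the problem (P): $y'' - y' + y = y^3$ on $-\infty < x < \infty$, with $y(0)=0$, $\lim_{x\to\infty} y(x)=1$, and $y(x)>0$ for $0<x<\infty$, where a solution is a real-valued twice differentiable function $y:\mathbb{R}\to\mathbb{R}$. Problem (P) has exactly one solution $y^*$. The zeros of $y^*$ are infinitely many and form a strictly decreasing sequence $\dots<x_n<\dots<x_1<x_0=0$ (that is, $\{x\in\mathbb{R}: y^*(x)=0\}=\{x_n : n=0,1,2,\dots\}$), with $x_n\to-\infty$ as $n\to\infty$. Moreover $\lim_{x\to-\infty}y^*(x)=0$, and $|y^*(x)|\le \tfrac12$ for all $x\in(-\infty,0]$. -/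

import Mathlib

open Filter Topology

/-- `y : ℝ → ℝ` solves the problem `y'' - y' + y = y ^ 3` on the whole real line,
`y(0) = 0`, `y(∞) = 1`, `y > 0` on `(0, ∞)`, in the classical sense: `y` is twice
differentiable everywhere (so that `deriv y` and `deriv (deriv y)` are the genuine derivatives). -/
structure IsSolutionP (y : ℝ → ℝ) : Prop where
  differentiable : Differentiable ℝ y
  differentiable_deriv : Differentiable ℝ (deriv y)
  ode : ∀ x : ℝ, deriv (deriv y) x - deriv y x + y x = y x ^ 3
  zero : y 0 = 0
  tendsto_one : Tendsto y atTop (𝓝 1)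
  pos : ∀ x : ℝ, 0 < x → 0 < y x

/-! ### Monotonicity from pointwise derivatives -/

/-! With `w = y'` the equation becomes the planar system `y' = w`, `w' = w - (y - y ^ 3)`, whose
energy `w ^ 2 / 2 + y ^ 2 / 2 - y ^ 4 / 4` grows at rate `w ^ 2`. On the right half-line a solution
increases strictly and stays below 1, so its energy stays below the limit 1/4.

Uniqueness (`IsSolutionP.unique`): slope is a function of height there. For two solutions the
squared difference of these functions is nondecreasing in the height, yet the energy bound forces it
to 0 at height 1. The slopes therefore agree, the solutions are translates, and the sign condition
excludes a shift.

Existence (`exists_isSolutionP`): shoot from height 0. The slopes whose trajectory turns back and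
those whose trajectory passes 1 form disjoint nonempty open sets, so by connectedness some slope
does neither; that trajectory rises to an equilibrium, which must be 1. The nonlinearity is
truncated so that trajectories are global; the bounds on `y` show that the truncation is inactive.

Left half-line: the energy gives `w 0 < 1 / √2 < 5 / 7`. Followed backwards, a trajectory reaching
`|y| = 1 / 2` would have to stay under a cubic curve that is already negative at `y = -1 / 2`
(`abs_le_half_of_nonpos`). Given this bound, a quadratic form decays exponentially at `-∞`, and
Sturm comparison puts a zero in every window of length `3π/2`; zeros are isolated by uniqueness for
the ODE. -/

theorem monotoneOn_of_hasDerivAt {D : Set ℝ} (hD : Convex ℝ D) {f f' : ℝ → ℝ}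
    (hf : ∀ x ∈ D, HasDerivAt f (f' x) x) (h : ∀ x ∈ D, 0 ≤ f' x) : MonotoneOn f D :=
  monotoneOn_of_hasDerivWithinAt_nonneg hD
    (fun x hx => (hf x hx).continuousAt.continuousWithinAt)
    (fun x hx => (hf x (interior_subset hx)).hasDerivWithinAt)
    (fun x hx => h x (interior_subset hx))

theorem antitoneOn_of_hasDerivAt {D : Set ℝ} (hD : Convex ℝ D) {f f' : ℝ → ℝ}
    (hf : ∀ x ∈ D, HasDerivAt f (f' x) x) (h : ∀ x ∈ D, f' x ≤ 0) : AntitoneOn f D :=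
  antitoneOn_of_hasDerivWithinAt_nonpos hD
    (fun x hx => (hf x hx).continuousAt.continuousWithinAt)
    (fun x hx => (hf x (interior_subset hx)).hasDerivWithinAt)
    (fun x hx => h x (interior_subset hx))

/-! ### Global solutions of `y'' = y' - g(y)` with `g` bounded and Lipschitz -/

/-- The phase-plane vector field of `y'' = y' - g y`. -/
def phaseField (g : ℝ → ℝ) (p : ℝ × ℝ) : ℝ × ℝ := (p.2, p.2 - g p.1)

theorem abs_clamp_sub_clamp_le (a b x y : ℝ) :
    |max a (min b x) - max a (min b y)| ≤ |x - y| := by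
  rw [max_comm a (min b x), max_comm a (min b y), min_comm b x, min_comm b y]
  exact (abs_max_sub_max_le_abs _ _ _).trans
    ((abs_min_sub_min_le_max x b y b).trans (by simp))

theorem abs_clamp_le {R : ℝ} (hR : 0 ≤ R) (x : ℝ) : |max (-R) (min R x)| ≤ |x| := by
  have := abs_clamp_sub_clamp_le (-R) R x 0
  simpa [hR] using this

theorem abs_clamp_le_bound {R : ℝ} (hR : 0 ≤ R) (x : ℝ) : |max (-R) (min R x)| ≤ R := by
  rw [abs_le]
  exact ⟨le_max_left _ _, max_le (by linarith) (min_le_left _ _)⟩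

theorem clamp_eq_self {R x : ℝ} (h : |x| ≤ R) : max (-R) (min R x) = x := by
  rw [abs_le] at h
  rw [min_eq_right h.2, max_eq_right h.1]

/-- Taking `c = id` gives the phase field itself, and taking `c` to be a clamp gives the bounded
field fed to Picard–Lindelöf. -/
theorem lipschitzWith_damped {g c : ℝ → ℝ} (hg : LipschitzWith 2 g)
    (hc : ∀ x y, |c x - c y| ≤ |x - y|) :
    LipschitzWith 3 (fun p : ℝ × ℝ => ((c p.2, c p.2 - g p.1) : ℝ × ℝ)) := by
  refine LipschitzWith.of_dist_le_mul fun p q => ?_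
  have h1 := hc p.2 q.2
  have h2 := hg.dist_le_mul p.1 q.1
  simp only [Prod.dist_eq, Real.dist_eq] at h2 ⊢
  have h3 : |p.1 - q.1| ≤ max |p.1 - q.1| |p.2 - q.2| := le_max_left _ _
  have h4 : |p.2 - q.2| ≤ max |p.1 - q.1| |p.2 - q.2| := le_max_right _ _
  have h5 : 0 ≤ |p.2 - q.2| := abs_nonneg _
  push_cast at h2 ⊢
  refine max_le (by linarith) ?_
  calc |c p.2 - g p.1 - (c q.2 - g q.1)|
      = |(c p.2 - c q.2) - (g p.1 - g q.1)| := by congr 1; ring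
    _ ≤ |c p.2 - c q.2| + |g p.1 - g q.1| := abs_sub _ _
    _ ≤ _ := by linarith

theorem lipschitzWith_phaseField {g : ℝ → ℝ} (hg : LipschitzWith 2 g) :
    LipschitzWith 3 (phaseField g) :=
  lipschitzWith_damped (c := id) hg fun _ _ => le_rfl

theorem abs_le_of_abs_deriv_le {w w' : ℝ → ℝ} {T : ℝ}
    (hw : ∀ t ∈ Set.Icc 0 T, HasDerivWithinAt w (w' t) (Set.Icc 0 T) t)
    (hb : ∀ t ∈ Set.Icc 0 T, |w' t| ≤ |w t| + 1) :
    ∀ t ∈ Set.Icc 0 T, |w t| ≤ gronwallBound |w 0| 1 1 T := by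
  intro t ht
  have h := norm_le_gronwallBound_of_norm_deriv_right_le (f := w) (f' := w') (δ := |w 0|)
    (K := 1) (ε := 1) (a := 0) (b := T) (fun x hx => (hw x hx).continuousWithinAt)
    (fun x hx => ((hw x (Set.Ico_subset_Icc_self hx)).mono_of_mem_nhdsWithin
      (Icc_mem_nhdsGE_of_mem hx))) le_rfl
    (fun x hx => by simpa using hb x (Set.Ico_subset_Icc_self hx)) t ht
  exact h.trans (gronwallBound_mono (abs_nonneg _) zero_le_one zero_le_one (by linarith [ht.2]))

/-- Clamping the velocity at its Gronwall bound `R` makes the field bounded, so Picard–Lindelöf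
covers all of `[-T, T]`. The clamped solution obeys the same growth estimate, so it never feels the
clamp. -/
theorem exists_phaseField_solution_Ioo {g : ℝ → ℝ} (hg : LipschitzWith 2 g)
    (hb : ∀ y, |g y| ≤ 1) (v : ℝ) {T : ℝ} (hT : 0 < T) :
    ∃ f : ℝ → ℝ × ℝ, f 0 = (0, v) ∧
      ∀ t ∈ Set.Ioo (-T) T, HasDerivAt f (phaseField g (f t)) t := by
  set R : ℝ := gronwallBound |v| 1 1 T with hR
  have hR0 : 0 ≤ R := (abs_nonneg v).trans <| by
    have := gronwallBound_mono (abs_nonneg v) zero_le_one zero_le_one hT.le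
    rwa [gronwallBound_x0] at this
  let F : ℝ × ℝ → ℝ × ℝ := fun p => (max (-R) (min R p.2), max (-R) (min R p.2) - g p.1)
  have hF : LipschitzWith 3 F := lipschitzWith_damped hg (abs_clamp_sub_clamp_le _ _)
  have hFb : ∀ p, ‖F p‖ ≤ R + 1 := by
    intro p
    have h1 := abs_clamp_le_bound hR0 p.2
    refine max_le (by simpa using h1.trans (by linarith)) ?_
    exact (abs_sub _ _).trans (add_le_add h1 (hb _))
  have hpl : IsPicardLindelof (fun _ => F) (tmin := -T) (tmax := T) ⟨0, by simp [hT.le]⟩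
      ((0, v) : ℝ × ℝ) ⟨(R + 1) * T, by positivity⟩ 0 ⟨R + 1, by positivity⟩ 3 :=
    IsPicardLindelof.of_time_independent (fun x _ => hFb x) hF.lipschitzOnWith (by
      simp only [sub_zero, zero_sub, neg_neg, max_self, NNReal.coe_zero]
      exact le_rfl)
  obtain ⟨f, hf0, hf⟩ := hpl.exists_eq_forall_mem_Icc_hasDerivWithinAt₀
  have hd : ∀ t, |max (-R) (min R (f t).2) - g (f t).1| ≤ |(f t).2| + 1 := fun t =>
    (abs_sub _ _).trans (add_le_add (abs_clamp_le hR0 _) (hb _))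
  have hw0 : (f 0).2 = v := by rw [show f 0 = (0, v) from hf0]
  have hw : ∀ t ∈ Set.Icc (-T) T, HasDerivWithinAt (fun t => (f t).2)
      (max (-R) (min R (f t).2) - g (f t).1) (Set.Icc (-T) T) t := fun t ht =>
    (hasFDerivAt_snd (𝕜 := ℝ) (p := f t)).comp_hasDerivWithinAt t (hf t ht)
  have hright : ∀ t ∈ Set.Icc 0 T, |(f t).2| ≤ R := by
    have := abs_le_of_abs_deriv_le (w := fun t => (f t).2)
      (fun t ht => (hw t ⟨by linarith [ht.1], ht.2⟩).mono
        (Set.Icc_subset_Icc (by linarith) le_rfl)) (fun t _ => hd t)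
    simpa only [hw0] using this
  have hleft : ∀ t ∈ Set.Icc 0 T, |(f (-t)).2| ≤ R := by
    have := abs_le_of_abs_deriv_le (w := fun t => (f (-t)).2) (T := T)
      (w' := fun t => -(max (-R) (min R (f (-t)).2) - g (f (-t)).1))
      (fun t ht => by
        have h1 := hw (-t) ⟨by linarith [ht.2], by linarith [ht.1]⟩
        have h2 : HasDerivWithinAt (fun t : ℝ => -t) (-1) (Set.Icc 0 T) t :=
          (hasDerivAt_neg t).hasDerivWithinAt
        have h3 := h1.scomp t h2 (fun s hs => ⟨by linarith [hs.2], by linarith [hs.1]⟩)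
        simpa [Function.comp_def] using h3)
      (fun t _ => by rw [abs_neg]; exact hd (-t))
    simpa only [neg_zero, hw0] using this
  refine ⟨f, hf0, fun t ht => ?_⟩
  have hbd : |(f t).2| ≤ R := by
    rcases le_total 0 t with h | h
    · exact hright t ⟨h, ht.2.le⟩
    · simpa using hleft (-t) ⟨by linarith, by linarith [ht.1]⟩
  have h1 := (hf t (Set.Ioo_subset_Icc_self ht)).hasDerivAt (Icc_mem_nhds ht.1 ht.2)
  have h2 : F (f t) = phaseField g (f t) := by
    simp only [F, phaseField, clamp_eq_self hbd]
  rwa [h2] at h1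

/-- Solutions on `(-(n + 1), n + 1)` agree on overlaps by uniqueness; at time `t` the one with `n =
⌊|t|⌋₊` is used. -/
theorem exists_phaseField_solution {g : ℝ → ℝ} (hg : LipschitzWith 2 g)
    (hb : ∀ y, |g y| ≤ 1) (v : ℝ) :
    ∃ f : ℝ → ℝ × ℝ, f 0 = (0, v) ∧ ∀ t, HasDerivAt f (phaseField g (f t)) t := by
  have key : ∀ n : ℕ, ∃ f : ℝ → ℝ × ℝ, f 0 = (0, v) ∧
      ∀ t ∈ Set.Ioo (-((n : ℝ) + 1)) (n + 1), HasDerivAt f (phaseField g (f t)) t :=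
    fun n => exists_phaseField_solution_Ioo hg hb v (by positivity)
  choose f hf0 hf using key
  have hmono : ∀ m n : ℕ, m ≤ n → ∀ t ∈ Set.Ioo (-((m : ℝ) + 1)) (m + 1), f m t = f n t := by
    intro m n hmn
    have hcast : (m : ℝ) ≤ n := by exact_mod_cast hmn
    refine ODE_solution_unique_of_mem_Ioo (v := fun _ => phaseField g) (s := fun _ => Set.univ)
      (t₀ := 0) (fun _ _ => (lipschitzWith_phaseField hg).lipschitzOnWith)
      ⟨by linarith [m.cast_nonneg (α := ℝ)], by positivity⟩ (fun t ht => ⟨hf m t ht, trivial⟩)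
      (fun t ht => ⟨hf n t ⟨by linarith [ht.1], by linarith [ht.2]⟩, trivial⟩) ?_
    rw [hf0, hf0]
  have hmem : ∀ t : ℝ, t ∈ Set.Ioo (-((⌊|t|⌋₊ : ℝ) + 1)) (⌊|t|⌋₊ + 1) := fun t =>
    abs_lt.1 (Nat.lt_floor_add_one _)
  refine ⟨fun t => f ⌊|t|⌋₊ t, by simp [hf0], fun t => ?_⟩
  have heq : ∀ n : ℕ, ∀ s ∈ Set.Ioo (-((n : ℝ) + 1)) (n + 1), f ⌊|s|⌋₊ s = f n s := by
    intro n s hs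
    rcases le_total ⌊|s|⌋₊ n with h | h
    · exact hmono _ _ h s (hmem s)
    · exact (hmono _ _ h s hs).symm
  refine (hf ⌊|t|⌋₊ t (hmem t)).congr_of_eventuallyEq ?_
  filter_upwards [Ioo_mem_nhds (hmem t).1 (hmem t).2] with s hs using heq _ s hs

/-! ### The truncated cubic nonlinearity -/

/-- `c - c ^ 3`, where `c` is the projection of `y` to `[a, 1]`. -/
def truncCubic (a y : ℝ) : ℝ := max a (min 1 y) - max a (min 1 y) ^ 3

theorem truncCubic_of_mem {a y : ℝ} (h1 : a ≤ y) (h2 : y ≤ 1) : truncCubic a y = y - y ^ 3 := by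
  rw [truncCubic, min_eq_right h2, max_eq_right h1]

theorem truncCubic_of_one_le {a y : ℝ} (ha : a ≤ 1) (h : 1 ≤ y) : truncCubic a y = 0 := by
  rw [truncCubic, min_eq_left h, max_eq_right ha]; norm_num

theorem clamp_mem {a : ℝ} (ha : a ≤ 1) (y : ℝ) : max a (min 1 y) ∈ Set.Icc a 1 :=
  ⟨le_max_left _ _, max_le ha (min_le_left _ _)⟩

theorem truncCubic_zero_nonneg (y : ℝ) : 0 ≤ truncCubic 0 y := by
  obtain ⟨h1, h2⟩ := clamp_mem zero_le_one y
  rw [truncCubic]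
  nlinarith [mul_nonneg h1 (sub_nonneg.2 h2), mul_nonneg (mul_nonneg h1 h1) (sub_nonneg.2 h2)]

theorem abs_truncCubic_le {a : ℝ} (ha : -1 ≤ a) (ha' : a ≤ 1) (y : ℝ) :
    |truncCubic a y| ≤ 1 / 2 := by
  obtain ⟨h1, h2⟩ := clamp_mem ha' y
  rw [truncCubic]
  set c := max a (min 1 y)
  have h3 : -1 ≤ c := ha.trans h1
  rw [abs_le]
  constructor
  -- The upper bound comes from `(c + 1) * (c - 1 / 2) ^ 2 ≥ 0`, that is `c - c ^ 3 ≤ (c + 1) / 4`;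
  -- the lower one is its mirror image.
  · nlinarith [mul_nonneg (sub_nonneg.2 h2) (sq_nonneg (c + 1 / 2)), sq_nonneg (c + 1 / 2)]
  · nlinarith [mul_nonneg (neg_le_iff_add_nonneg.1 h3) (sq_nonneg (c - 1 / 2)),
      sq_nonneg (c - 1 / 2)]

theorem lipschitzWith_truncCubic {a : ℝ} (ha : -1 ≤ a) (ha' : a ≤ 1) :
    LipschitzWith 2 (truncCubic a) := by
  refine LipschitzWith.of_dist_le_mul fun x y => ?_
  obtain ⟨hx1, hx2⟩ := clamp_mem ha' x
  obtain ⟨hy1, hy2⟩ := clamp_mem ha' y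
  have h := abs_clamp_sub_clamp_le a 1 x y
  rw [Real.dist_eq, Real.dist_eq, truncCubic, truncCubic]
  set c := max a (min 1 x)
  set d := max a (min 1 y)
  have e : c - c ^ 3 - (d - d ^ 3) = (1 - (c ^ 2 + c * d + d ^ 2)) * (c - d) := by ring
  have hc : c ^ 2 ≤ 1 := by nlinarith
  have hd : d ^ 2 ≤ 1 := by nlinarith
  rw [e, abs_mul]
  push_cast
  refine mul_le_mul ?_ h (abs_nonneg _) (by norm_num)
  rw [abs_le]
  constructor <;> nlinarith [sq_nonneg (c - d), sq_nonneg (c + d)]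

/-! ### Solutions of `y'' - y' + y = y ^ 3` in the phase plane -/

/-- On `D`, the pair `(y, w)` solves `y' = w`, `w' = w - (y - y ^ 3)`. -/
def IsCubicSolOn (y w : ℝ → ℝ) (D : Set ℝ) : Prop :=
  ∀ t ∈ D, HasDerivAt y (w t) t ∧ HasDerivAt w (w t - (y t - y t ^ 3)) t

theorem IsCubicSolOn.mono {y w : ℝ → ℝ} {D D' : Set ℝ} (h : IsCubicSolOn y w D) (hD : D' ⊆ D) :
    IsCubicSolOn y w D' := fun t ht => h t (hD ht)

theorem IsCubicSolOn.neg {y w : ℝ → ℝ} {D : Set ℝ} (h : IsCubicSolOn y w D) :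
    IsCubicSolOn (fun t => -y t) (fun t => -w t) D := fun t ht =>
  ⟨(h t ht).1.neg, (h t ht).2.neg.congr_deriv (by ring)⟩

theorem IsCubicSolOn.comp_add_const {y w : ℝ → ℝ} (h : IsCubicSolOn y w Set.univ) (c : ℝ) :
    IsCubicSolOn (fun t => y (t + c)) (fun t => w (t + c)) Set.univ := fun t _ =>
  ⟨(h (t + c) trivial).1.comp_add_const t c, (h (t + c) trivial).2.comp_add_const t c⟩

theorem IsSolutionP.isCubicSolOn {y : ℝ → ℝ} (h : IsSolutionP y) :
    IsCubicSolOn y (deriv y) Set.univ := fun t _ =>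
  ⟨(h.differentiable t).hasDerivAt, by
    have := (h.differentiable_deriv t).hasDerivAt
    rwa [show deriv (deriv y) t = deriv y t - (y t - y t ^ 3) by linarith [h.ode t]] at this⟩

theorem lipschitzOnWith_phaseField_cubic (R : ℝ) :
    LipschitzOnWith ⟨2 + 3 * R ^ 2, by positivity⟩ (phaseField fun y => y - y ^ 3)
      {p | |p.1| ≤ R} := by
  refine LipschitzOnWith.of_dist_le_mul fun p hp q hq => ?_
  have hp' : |p.1| ≤ R := hp
  have hq' : |q.1| ≤ R := hq
  have h3 : |p.1 - q.1| ≤ max |p.1 - q.1| |p.2 - q.2| := le_max_left _ _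
  have h4 : |p.2 - q.2| ≤ max |p.1 - q.1| |p.2 - q.2| := le_max_right _ _
  simp only [Prod.dist_eq, Real.dist_eq, phaseField]
  set m := max |p.1 - q.1| |p.2 - q.2|
  have hm : 0 ≤ m := (abs_nonneg _).trans h3
  have hcub : |p.1 ^ 2 + p.1 * q.1 + q.1 ^ 2| ≤ 3 * R ^ 2 := by
    rw [abs_le] at hp' hq' ⊢
    constructor <;> nlinarith [sq_nonneg (p.1 + q.1), sq_nonneg (p.1 - q.1)]
  refine max_le (h4.trans ?_) ?_
  · change m ≤ (2 + 3 * R ^ 2) * m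
    nlinarith [mul_nonneg (sq_nonneg R) hm]
  · change _ ≤ (2 + 3 * R ^ 2) * m
    have e : p.2 - (p.1 - p.1 ^ 3) - (q.2 - (q.1 - q.1 ^ 3)) =
      (p.2 - q.2) - (p.1 - q.1) + (p.1 ^ 2 + p.1 * q.1 + q.1 ^ 2) * (p.1 - q.1) := by ring
    rw [e]
    calc _ ≤ |p.2 - q.2 - (p.1 - q.1)| + |(p.1 ^ 2 + p.1 * q.1 + q.1 ^ 2) * (p.1 - q.1)| :=
          abs_add_le _ _
      _ ≤ (|p.2 - q.2| + |p.1 - q.1|) + 3 * R ^ 2 * m := by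
          rw [abs_mul]
          exact add_le_add (abs_sub _ _) (mul_le_mul hcub h3 (abs_nonneg _) (by positivity))
      _ ≤ _ := by linarith

theorem IsCubicSolOn.hasDerivAt_prod {y w : ℝ → ℝ} {D : Set ℝ} (h : IsCubicSolOn y w D) {t : ℝ}
    (ht : t ∈ D) : HasDerivAt (fun t => (y t, w t))
      (phaseField (fun y => y - y ^ 3) (y t, w t)) t :=
  (h t ht).1.prodMk (h t ht).2

theorem IsCubicSolOn.continuous {y w : ℝ → ℝ} (h : IsCubicSolOn y w Set.univ) : Continuous y :=
  continuous_iff_continuousAt.2 fun t => (h t trivial).1.continuousAt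

/-- The cubic field is Lipschitz on strips `|y| ≤ R`, and on a compact time interval both solutions
stay in one strip. -/
theorem IsCubicSolOn.unique {y w z u : ℝ → ℝ} (h : IsCubicSolOn y w Set.univ)
    (h' : IsCubicSolOn z u Set.univ) {t₀ : ℝ} (hy : y t₀ = z t₀) (hw : w t₀ = u t₀) : y = z := by
  funext t
  set T : ℝ := |t| + |t₀| + 1
  have ht : t ∈ Set.Ioo (-T) T :=
    abs_lt.1 (by linarith [abs_nonneg t₀] : |t| < |t| + |t₀| + 1)
  have ht₀ : t₀ ∈ Set.Ioo (-T) T :=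
    abs_lt.1 (by linarith [abs_nonneg t] : |t₀| < |t| + |t₀| + 1)
  obtain ⟨R, hR⟩ := isCompact_Icc.exists_bound_of_continuousOn (s := Set.Icc (-T) T)
    h.continuous.continuousOn
  obtain ⟨S, hS⟩ := isCompact_Icc.exists_bound_of_continuousOn (s := Set.Icc (-T) T)
    h'.continuous.continuousOn
  have hR0 : 0 ≤ R := (norm_nonneg _).trans (hR t (Set.Ioo_subset_Icc_self ht))
  have := ODE_solution_unique_of_mem_Ioo (v := fun _ => phaseField fun y => y - y ^ 3)
    (s := fun _ => {p : ℝ × ℝ | |p.1| ≤ max R S}) (f := fun t => (y t, w t))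
    (g := fun t => (z t, u t)) (a := -T) (b := T)
    (fun _ _ => lipschitzOnWith_phaseField_cubic _) ht₀
    (fun s hs => ⟨h.hasDerivAt_prod trivial,
      (hR s (Set.Ioo_subset_Icc_self hs)).trans (le_max_left _ _)⟩)
    (fun s hs => ⟨h'.hasDerivAt_prod trivial,
      (hS s (Set.Ioo_subset_Icc_self hs)).trans (le_max_right _ _)⟩)
    (by simp only [hy, hw]) ht
  exact congrArg Prod.fst this

theorem isCubicSolOn_const {c : ℝ} (hc : c - c ^ 3 = 0) (D : Set ℝ) :
    IsCubicSolOn (fun _ => c) (fun _ => 0) D := fun t _ =>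
  ⟨hasDerivAt_const t c, by simpa [hc] using hasDerivAt_const t (0 : ℝ)⟩

/-- The energy `w ^ 2 / 2 + y ^ 2 / 2 - y ^ 4 / 4` has derivative `w ^ 2` along solutions. -/
theorem IsCubicSolOn.hasDerivAt_energy {y w : ℝ → ℝ} {D : Set ℝ} (h : IsCubicSolOn y w D) {t : ℝ}
    (ht : t ∈ D) :
    HasDerivAt (fun t => w t ^ 2 / 2 + y t ^ 2 / 2 - y t ^ 4 / 4) (w t ^ 2) t := by
  have h1 := (h t ht).1
  have h2 := (h t ht).2
  refine HasDerivAt.congr_deriv ((((h2.pow 2).div_const 2).add ((h1.pow 2).div_const 2)).sub ((h1.pow 4).div_const 4)) ?_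
  push_cast
  ring

theorem IsCubicSolOn.monotoneOn_energy {y w : ℝ → ℝ} {D : Set ℝ} (h : IsCubicSolOn y w D)
    (hD : Convex ℝ D) :
    MonotoneOn (fun t => w t ^ 2 / 2 + y t ^ 2 / 2 - y t ^ 4 / 4) D :=
  monotoneOn_of_hasDerivAt hD (fun _ ht => h.hasDerivAt_energy ht) fun _ _ => sq_nonneg _

/-! ### Oscillation of small solutions -/

/-- Sturm comparison: a small nonnegative solution vanishes after time `3π/2`. -/
theorem IsCubicSolOn.nonpos_of_small {y w : ℝ → ℝ} {a : ℝ}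
    (h : IsCubicSolOn y w (Set.Icc a (a + 3 * Real.pi / 2)))
    (h0 : ∀ t ∈ Set.Icc a (a + 3 * Real.pi / 2), 0 ≤ y t)
    (h1 : ∀ t ∈ Set.Icc a (a + 3 * Real.pi / 2), y t ≤ 1 / 2) :
    y (a + 3 * Real.pi / 2) ≤ 0 := by
  set b := a + 3 * Real.pi / 2 with hb
  have hab : a ≤ b := by linarith [Real.pi_pos]
  -- For `z = exp (-t / 2) * y` one has `z'' = -(3 / 4 - y ^ 2) * z`, with coefficient at least `1 /
  -- 2 > 4 / 9`. The function below is the Wronskian of `z` with `sin (2 / 3 * (t - a))`, whose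
  -- half-period is `3π/2`.
  have hanti : AntitoneOn (fun t => Real.exp (-t / 2) * ((w t - y t / 2) * Real.sin (2 / 3 * (t - a))
      - 2 / 3 * (y t * Real.cos (2 / 3 * (t - a))))) (Set.Icc a b) := by
    refine antitoneOn_of_hasDerivAt (f' := fun t => Real.exp (-t / 2) *
      (Real.sin (2 / 3 * (t - a)) * y t * (y t ^ 2 - 3 / 4 + 4 / 9))) (convex_Icc a b) ?_ ?_
    · intro t ht
      have hy := (h t ht).1
      have hw := (h t ht).2
      have hl : HasDerivAt (fun t : ℝ => 2 / 3 * (t - a)) (2 / 3) t := by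
        simpa using ((hasDerivAt_id t).sub_const a).const_mul (2 / 3 : ℝ)
      have he : HasDerivAt (fun t : ℝ => Real.exp (-t / 2)) (Real.exp (-t / 2) * (-1 / 2)) t :=
        ((hasDerivAt_neg t).div_const 2).exp
      refine HasDerivAt.congr_deriv (he.mul (((hw.sub (hy.div_const 2)).mul hl.sin).sub
        ((hy.mul hl.cos).const_mul (2 / 3 : ℝ)))) ?_
      simp only [Pi.sub_apply]
      ring
    · intro t ht
      have hs : 0 ≤ Real.sin (2 / 3 * (t - a)) :=
        Real.sin_nonneg_of_nonneg_of_le_pi (by linarith [ht.1]) (by linarith [ht.2])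
      have := mul_nonneg hs (h0 t ht)
      have hq : y t ^ 2 - 3 / 4 + 4 / 9 ≤ 0 := by nlinarith [h0 t ht, h1 t ht]
      exact mul_nonpos_of_nonneg_of_nonpos (Real.exp_pos _).le
        (mul_nonpos_of_nonneg_of_nonpos this hq)
  have := hanti (Set.left_mem_Icc.2 hab) (Set.right_mem_Icc.2 hab) hab
  have e : 2 / 3 * (b - a) = Real.pi := by rw [hb]; ring
  simp only [e, sub_self, mul_zero, Real.sin_zero, Real.cos_zero, Real.sin_pi, Real.cos_pi] at this
  have ha := mul_nonneg (Real.exp_pos (-a / 2)).le (h0 a (Set.left_mem_Icc.2 hab))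
  have hbp : Real.exp (-b / 2) * y b ≤ 0 := by linarith
  exact nonpos_of_mul_nonpos_right hbp (Real.exp_pos _)

theorem IsCubicSolOn.exists_zero_of_small {y w : ℝ → ℝ} (h : IsCubicSolOn y w Set.univ) {a : ℝ}
    (h1 : ∀ t ∈ Set.Icc a (a + 3 * Real.pi / 2), |y t| ≤ 1 / 2) :
    ∃ t ∈ Set.Icc a (a + 3 * Real.pi / 2), y t = 0 := by
  by_contra! hne
  set b := a + 3 * Real.pi / 2 with hb
  have hab : a ≤ b := by linarith [Real.pi_pos]
  have hsign : (∀ t ∈ Set.Icc a b, 0 < y t) ∨ ∀ t ∈ Set.Icc a b, y t < 0 := by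
    by_contra! hcon
    obtain ⟨⟨s, hs, hs0⟩, t, ht, ht0⟩ := hcon
    obtain ⟨r, hr, hr0⟩ := (isPreconnected_Icc (a := a) (b := b)).intermediate_value hs ht
      h.continuous.continuousOn ⟨hs0, ht0⟩
    exact hne r hr hr0
  rcases hsign with hp | hn
  · exact absurd (hp b (Set.right_mem_Icc.2 hab)) (not_lt.2
      ((h.mono (Set.subset_univ _)).nonpos_of_small (fun t ht => (hp t ht).le)
        fun t ht => (abs_le.1 (h1 t ht)).2))
  · have := (h.neg.mono (Set.subset_univ _)).nonpos_of_small (a := a)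
      (fun t ht => neg_nonneg.2 (hn t ht).le) fun t ht => by linarith [(abs_le.1 (h1 t ht)).1]
    linarith [hn b (Set.right_mem_Icc.2 hab)]

/-- The positive definite form `L = w ^ 2 - w * y + y ^ 2` satisfies `L' = L` for the linearised
system. When `|y| ≤ 1 / 2` the cubic term costs at most half of this, so `L t ≤ L 0 * exp (t / 2)`
for `t ≤ 0`. -/
theorem IsCubicSolOn.tendsto_zero_atBot {y w : ℝ → ℝ} (h : IsCubicSolOn y w Set.univ)
    (h1 : ∀ t ≤ 0, |y t| ≤ 1 / 2) : Tendsto y atBot (𝓝 0) := by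
  set L : ℝ → ℝ := fun t => w t ^ 2 - w t * y t + y t ^ 2 with hL
  have hmono : MonotoneOn (fun t => Real.exp (-t / 2) * L t) (Set.Iic 0) := by
    refine monotoneOn_of_hasDerivAt (f' := fun t => Real.exp (-t / 2) *
      (L t / 2 + y t ^ 3 * (2 * w t - y t))) (convex_Iic 0) ?_ ?_
    · intro t _
      have hy := (h t trivial).1
      have hw := (h t trivial).2
      have he : HasDerivAt (fun t : ℝ => Real.exp (-t / 2)) (Real.exp (-t / 2) * (-1 / 2)) t :=
        ((hasDerivAt_neg t).div_const 2).exp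
      refine HasDerivAt.congr_deriv (he.mul (((hw.pow 2).sub (hw.mul hy)).add (hy.pow 2))) ?_
      simp only [hL]
      push_cast
      ring
    · intro t ht
      refine mul_nonneg (Real.exp_pos _).le ?_
      have hb := abs_le.1 (h1 t ht)
      have hy2 : y t ^ 2 ≤ 1 / 4 := by nlinarith
      simp only [hL]
      have hy4 : y t ^ 2 * y t ^ 2 ≤ 1 / 4 * y t ^ 2 :=
        mul_le_mul_of_nonneg_right hy2 (sq_nonneg _)
      have hw2 : y t ^ 2 * (2 * w t - y t) ^ 2 ≤ 1 / 4 * (2 * w t - y t) ^ 2 :=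
        mul_le_mul_of_nonneg_right hy2 (sq_nonneg _)
      nlinarith [sq_nonneg (y t * (y t + 2 / 3 * (2 * w t - y t))),
        sq_nonneg (y t * (y t + (2 * w t - y t))), sq_nonneg (2 * w t - y t)]
  have hbound : ∀ t ≤ 0, y t ^ 2 ≤ 4 / 3 * (L 0 * Real.exp (t / 2)) := by
    intro t ht
    have h2 := hmono ht (Set.self_mem_Iic) ht
    simp only [neg_zero, zero_div, Real.exp_zero, one_mul] at h2
    have h3 : L t ≤ L 0 * Real.exp (t / 2) := by
      have := mul_le_mul_of_nonneg_right h2 (Real.exp_pos (t / 2)).le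
      rwa [mul_right_comm, ← Real.exp_add, show -t / 2 + t / 2 = 0 by ring, Real.exp_zero,
        one_mul] at this
    have h4 : 3 / 4 * y t ^ 2 ≤ L t := by simp only [hL]; nlinarith [sq_nonneg (2 * w t - y t)]
    linarith
  have hlim : Tendsto (fun t => 4 / 3 * (L 0 * Real.exp (t / 2))) atBot (𝓝 0) := by
    have : Tendsto (fun t : ℝ => Real.exp (t / 2)) atBot (𝓝 0) :=
      Real.tendsto_exp_atBot.comp (tendsto_id.atBot_div_const two_pos)
    simpa using (this.const_mul (L 0)).const_mul (4 / 3)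
  have hsq : Tendsto (fun t => y t ^ 2) atBot (𝓝 0) :=
    squeeze_zero' (Eventually.of_forall fun t => sq_nonneg _)
      ((eventually_le_atBot 0).mono hbound) hlim
  have := hsq.sqrt
  simp only [Real.sqrt_sq_eq_abs, Real.sqrt_zero] at this
  exact (tendsto_zero_iff_abs_tendsto_zero _).2 this

/-! ### The bound on the left half-line -/

theorem exists_last_abs_eq {y : ℝ → ℝ} (hy : Continuous y) {c t : ℝ} (h0 : |y 0| < c)
    (ht : t ≤ 0) (hc : c < |y t|) :
    ∃ s ≤ 0, |y s| = c ∧ ∀ r ∈ Set.Ioc s 0, |y r| < c := by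
  have hiv : ∀ r ≤ 0, c ≤ |y r| → ∃ s ∈ Set.Icc r 0, |y s| = c := fun r hr hcr => by
    obtain ⟨s, hs, hsc⟩ := intermediate_value_Icc' hr hy.abs.continuousOn ⟨h0.le, hcr⟩
    exact ⟨s, hs, hsc⟩
  obtain ⟨s₁, hs₁, hs₁c⟩ := hiv t ht hc.le
  have hcomp : IsCompact (Set.Icc t 0 ∩ {s | |y s| = c}) :=
    isCompact_Icc.inter_right (isClosed_eq hy.abs continuous_const)
  obtain ⟨s, ⟨hs, hsc⟩, hmax⟩ := hcomp.exists_isGreatest ⟨s₁, hs₁, hs₁c⟩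
  refine ⟨s, hs.2, hsc, fun r hr => ?_⟩
  by_contra! hcr
  obtain ⟨q, hq, hqc⟩ := hiv r hr.2 hcr
  have := hmax ⟨⟨hs.1.trans (hr.1.le.trans hq.1), hq.2⟩, hqc⟩
  linarith [hr.1, hq.1]

/-- A trajectory in the quadrant `y ≤ 0 ≤ w` that reaches `(0, v)` with `v ≤ 5 / 7` lies below
a cubic curve, which meets the axis `w = 0` at some `y > -1 / 2`. -/
theorem IsCubicSolOn.le_barrier {y w : ℝ → ℝ} {a : ℝ} (ha : a ≤ 0) (hc : Continuous y)
    (h : IsCubicSolOn y w (Set.Icc a 0)) (h0 : y 0 = 0) (hv : w 0 ≤ 5 / 7)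
    (hy : ∀ t ∈ Set.Icc a 0, y t ≤ 0) :
    w a ≤ 5 / 7 + y a - 7 / 10 * y a ^ 2 + 1 / 2 * y a ^ 3 := by
  set m : ℝ → ℝ := fun t => 7 / 5 * y t - 3 / 2 * y t ^ 2 with hm
  have hmc : Continuous m := by fun_prop
  set I : ℝ → ℝ := fun t => ∫ s in (0 : ℝ)..t, m s with hI
  have hId : ∀ t, HasDerivAt I (m t) t := fun t =>
    intervalIntegral.integral_hasDerivAt_right (hmc.intervalIntegrable _ _)
      hmc.stronglyMeasurable.stronglyMeasurableAtFilter hmc.continuousAt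
  -- `F` is `w` minus the cubic, and `F' = m * F + r` with `r ≥ 0` for `y ≤ 0`; `exp (-I)` is the
  -- integrating factor. The coefficient `7 / 10` is chosen so that the linear term of `r` cancels
  -- (`7 / 5 * (5 / 7) = 1`).
  set F : ℝ → ℝ := fun t => w t - y t + 7 / 10 * y t ^ 2 - 1 / 2 * y t ^ 3 - 5 / 7 with hF
  have hmono : MonotoneOn (fun t => Real.exp (-I t) * F t) (Set.Icc a 0) := by
    refine monotoneOn_of_hasDerivAt (f' := fun t => Real.exp (-I t) *
      (-y t + y t ^ 3 + m t * (5 / 7 + y t - 7 / 10 * y t ^ 2 + 1 / 2 * y t ^ 3)))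
      (convex_Icc a 0) ?_ ?_
    · intro t ht
      have hy := (h t ht).1
      have hw := (h t ht).2
      refine HasDerivAt.congr_deriv (((hId t).neg.exp).mul ((((hw.sub hy).add ((hy.pow 2).const_mul (7 / 10 : ℝ))).sub
        ((hy.pow 3).const_mul (1 / 2 : ℝ))).sub_const (5 / 7))) ?_
      simp only [hF, hm, Pi.neg_apply]
      push_cast
      ring
    · intro t ht
      refine mul_nonneg (Real.exp_pos _).le ?_
      have hz : 0 ≤ -y t := neg_nonneg.2 (hy t ht)
      simp only [hm]
      have e : -y t + y t ^ 3 + (7 / 5 * y t - 3 / 2 * y t ^ 2) *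
          (5 / 7 + y t - 7 / 10 * y t ^ 2 + 1 / 2 * y t ^ 3) =
        (-y t) ^ 2 * (7 / 5 - 15 / 14 + (-y t) * (3 / 2 - 1 + 49 / 50)
          + (-y t) ^ 2 * (7 / 10 + 21 / 20) + 3 / 4 * (-y t) ^ 3) := by ring
      rw [e]
      positivity
  have h2 := hmono (Set.left_mem_Icc.2 ha) (Set.right_mem_Icc.2 ha) ha
  have h3 : F 0 ≤ 0 := by simp only [hF, h0]; linarith
  have h4 : Real.exp (-I a) * F a ≤ 0 :=
    h2.trans (mul_nonpos_of_nonneg_of_nonpos (Real.exp_pos _).le h3)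
  have h5 : F a ≤ 0 := nonpos_of_mul_nonpos_right h4 (Real.exp_pos _)
  simp only [hF] at h5
  linarith

/-- The bound only uses the equation where `|y| ≤ 1 / 2`. -/
theorem abs_le_half_of_nonpos {y w g : ℝ → ℝ}
    (h : ∀ t, HasDerivAt y (w t) t ∧ HasDerivAt w (w t - g (y t)) t)
    (hg : ∀ x, |x| ≤ 1 / 2 → g x = x - x ^ 3) (h0 : y 0 = 0) (hv0 : 0 < w 0)
    (hv : w 0 ≤ 5 / 7) : ∀ t ≤ 0, |y t| ≤ 1 / 2 := by
  intro t ht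
  by_contra! hcon
  have hyc : Continuous y := continuous_iff_continuousAt.2 fun t => (h t).1.continuousAt
  have hwc : Continuous w := continuous_iff_continuousAt.2 fun t => (h t).2.continuousAt
  obtain ⟨a, ha, hya, hlt⟩ := exists_last_abs_eq hyc (by simp [h0]) ht hcon
  have hle : ∀ s ∈ Set.Icc a 0, |y s| ≤ 1 / 2 := fun s hs => by
    rcases hs.1.eq_or_lt with rfl | h'
    · exact hya.le
    · exact (hlt s ⟨h', hs.2⟩).le
  have hsol : IsCubicSolOn y w (Set.Icc a 0) := fun s hs => by
    have := h s
    rwa [hg _ (hle s hs)] at this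
  have hE := hsol.monotoneOn_energy (convex_Icc a 0)
  have hya2 : y a ^ 2 = 1 / 4 := by rw [← sq_abs, hya]; norm_num
  -- A turning point with `|y s| < 1 / 2` would have less energy than the earlier point `a`, since
  -- `y ^ 2 / 2 - y ^ 4 / 4` increases with `|y|` there.
  have hwne : ∀ s ∈ Set.Ioc a 0, w s ≠ 0 := by
    intro s hs hws
    have h1 := hE (Set.left_mem_Icc.2 ha) (Set.Ioc_subset_Icc_self hs) hs.1.le
    have h2 : y s ^ 2 < 1 / 4 := by
      rw [← sq_abs]; nlinarith [hlt s hs, abs_nonneg (y s)]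
    simp only [hws] at h1
    have h3 : y a ^ 4 = 1 / 16 := by rw [show y a ^ 4 = (y a ^ 2) ^ 2 by ring, hya2]; norm_num
    rw [h3, hya2] at h1
    nlinarith [sq_nonneg (w a)]
  have hwpos : ∀ s ∈ Set.Ioc a 0, 0 < w s := by
    intro s hs
    by_contra! hcon'
    obtain ⟨r, hr, hr0⟩ := intermediate_value_Icc hs.2 hwc.continuousOn ⟨hcon', hv0.le⟩
    exact hwne r ⟨hs.1.trans_le hr.1, hr.2⟩ hr0
  have ha' : a < 0 := by
    rcases ha.eq_or_lt with rfl | h'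
    · rw [h0] at hya; norm_num at hya
    · exact h'
  have hwa : 0 ≤ w a := by
    have : Tendsto w (𝓝[>] a) (𝓝 (w a)) := hwc.continuousAt.continuousWithinAt
    refine ge_of_tendsto this ?_
    filter_upwards [Ioc_mem_nhdsGT ha'] with s hs using (hwpos s hs).le
  have hymono : MonotoneOn y (Set.Icc a 0) :=
    monotoneOn_of_hasDerivAt (convex_Icc a 0) (fun s _ => (h s).1) fun s hs => by
      rcases hs.1.eq_or_lt with rfl | h'
      · exact hwa
      · exact (hwpos s ⟨h', hs.2⟩).le
  have hynp : ∀ s ∈ Set.Icc a 0, y s ≤ 0 := fun s hs => by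
    have := hymono hs (Set.right_mem_Icc.2 ha) hs.2
    rwa [h0] at this
  have hya' : y a = -(1 / 2) := by
    rw [abs_of_nonpos (hynp a (Set.left_mem_Icc.2 ha))] at hya
    linarith
  -- At `y = -1 / 2` the cubic equals `-13 / 560`, contradicting `0 ≤ w a`.
  have := hsol.le_barrier ha hyc h0 hv hynp
  rw [hya'] at this
  norm_num at this
  linarith

/-! ### Behaviour at infinity -/

/-- Mean value theorem on `[x, x + 1]`. Applied to `w`, it forces the limit of `y` to be an
equilibrium. -/
theorem eq_zero_of_tendsto_deriv {f f' : ℝ → ℝ} {L c : ℝ}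
    (hf : ∀ x, 0 ≤ x → HasDerivAt f (f' x) x) (hL : Tendsto f atTop (𝓝 L))
    (hc : Tendsto f' atTop (𝓝 c)) : c = 0 := by
  have hmv : ∀ x : ℝ, ∃ ξ, 0 ≤ x → x ≤ ξ ∧ f' ξ = f (x + 1) - f x := by
    intro x
    by_cases hx : 0 ≤ x
    · obtain ⟨ξ, hξ, h⟩ := exists_hasDerivAt_eq_slope f f' (lt_add_one x)
        (fun t ht => (hf t (hx.trans ht.1)).continuousAt.continuousWithinAt)
        (fun t ht => hf t (hx.trans ht.1.le))
      exact ⟨ξ, fun _ => ⟨hξ.1.le, by simpa using h⟩⟩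
    · exact ⟨0, fun h => absurd h hx⟩
  choose ξ hξ using hmv
  have hξt : Tendsto ξ atTop atTop :=
    tendsto_atTop_mono' _ ((eventually_ge_atTop 0).mono fun x hx => (hξ x hx).1) tendsto_id
  have h1 : Tendsto (fun x => f (x + 1) - f x) atTop (𝓝 (L - L)) :=
    (hL.comp (tendsto_atTop_add_const_right _ 1 tendsto_id)).sub hL
  rw [sub_self] at h1
  exact tendsto_nhds_unique (hc.comp hξt)
    (h1.congr' ((eventually_ge_atTop 0).mono fun x hx => (hξ x hx).2.symm))

/-- Since `w - y` decreases, `w x` is controlled by the mean slope over `[x - 1, x]`, which tends to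
0. -/
theorem IsCubicSolOn.tendsto_deriv_zero {y w : ℝ → ℝ} (h : IsCubicSolOn y w (Set.Ici 0))
    (hy0 : ∀ x, 0 ≤ x → 0 ≤ y x) (hy1 : ∀ x, 0 ≤ x → y x ≤ 1) (hw : ∀ x, 0 ≤ x → 0 ≤ w x)
    {l : ℝ} (hl : Tendsto y atTop (𝓝 l)) : Tendsto w atTop (𝓝 0) := by
  have hanti : AntitoneOn (fun t => w t - y t) (Set.Ici 0) := by
    refine antitoneOn_of_hasDerivAt (f' := fun t => w t - (y t - y t ^ 3) - w t) (convex_Ici 0)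
      (fun t ht => (h t ht).2.sub (h t ht).1) fun t ht => ?_
    have h0 := hy0 t ht
    have h1 := hy1 t ht
    nlinarith [mul_nonneg h0 (sub_nonneg.2 h1), mul_nonneg (mul_nonneg h0 h0) (sub_nonneg.2 h1)]
  have hmono : MonotoneOn y (Set.Ici 0) :=
    monotoneOn_of_hasDerivAt (convex_Ici 0) (fun t ht => (h t ht).1) hw
  have hle : ∀ x, 1 ≤ x → w x ≤ 2 * (y x - y (x - 1)) := by
    intro x hx
    obtain ⟨ξ, hξ, hs⟩ := exists_hasDerivAt_eq_slope y w (sub_one_lt x)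
      (fun t ht => (h t (by have := ht.1; simp only [Set.mem_Ici]; linarith)
        ).1.continuousAt.continuousWithinAt)
      (fun t ht => (h t (by have := ht.1; simp only [Set.mem_Ici]; linarith)).1)
    have hξ0 : (0 : ℝ) ≤ ξ := by linarith [hξ.1]
    have hx0 : (0 : ℝ) ≤ x := by linarith
    have h1 := hanti hξ0 hx0 hξ.2.le
    have h2 := hmono (sub_nonneg.2 hx) hξ0 hξ.1.le
    simp only [sub_sub_cancel, div_one] at hs
    simp only at h1
    linarith
  have hlim : Tendsto (fun x => 2 * (y x - y (x - 1))) atTop (𝓝 0) := by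
    have := (hl.sub (hl.comp (tendsto_atTop_add_const_right atTop (-1 : ℝ) tendsto_id))).const_mul 2
    simpa [sub_eq_add_neg] using this
  exact squeeze_zero' ((eventually_ge_atTop 0).mono hw) ((eventually_ge_atTop 1).mono hle) hlim

/-! ### Solutions on the right half-line: bounds, monotonicity, uniqueness -/

namespace IsSolutionP

variable {y : ℝ → ℝ}

theorem nonneg (h : IsSolutionP y) {x : ℝ} (hx : 0 ≤ x) : 0 ≤ y x := by
  rcases hx.eq_or_lt with rfl | hx
  · exact h.zero.ge
  · exact (h.pos x hx).le

/-- At a maximum above 1 the equation gives `y'' = y ^ 3 - y > 0`, so the point is also a local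
minimum and `y` is locally constant, which is absurd. -/
theorem le_one (h : IsSolutionP y) {x : ℝ} (hx : 0 ≤ x) : y x ≤ 1 := by
  by_contra! hcon
  obtain ⟨M, hM⟩ := eventually_atTop.1 (h.tendsto_one.eventually_lt_const hcon)
  obtain ⟨x₀, hx₀, hmax⟩ := (isCompact_Icc (a := (0 : ℝ)) (b := max M x)).exists_isMaxOn
    ⟨x, hx, le_max_right _ _⟩ h.differentiable.continuous.continuousOn
  have hxx₀ : y x ≤ y x₀ := hmax ⟨hx, le_max_right _ _⟩
  have hall : ∀ t, 0 ≤ t → y t ≤ y x₀ := fun t ht => by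
    rcases le_total t (max M x) with h' | h'
    · exact hmax ⟨ht, h'⟩
    · exact (hM t ((le_max_left _ _).trans h')).le.trans hxx₀
  have hx₀pos : 0 < x₀ := by
    rcases hx₀.1.eq_or_lt with h' | h'
    · rw [← h', h.zero] at hxx₀; linarith
    · exact h'
  have hlmax : IsLocalMax y x₀ := by
    filter_upwards [Ioi_mem_nhds hx₀pos] with t ht using hall t (le_of_lt ht)
  have hd0 := hlmax.deriv_eq_zero
  have hdd : 0 < deriv (deriv y) x₀ := by
    have h1 := h.ode x₀
    rw [hd0] at h1
    have h2 : 1 < y x₀ := hcon.trans_le hxx₀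
    have h3 : 1 < y x₀ ^ 2 := by nlinarith
    nlinarith
  have hlmin := isLocalMin_of_deriv_deriv_pos hdd hd0 h.differentiable.continuous.continuousAt
  have heq : y =ᶠ[𝓝 x₀] fun _ => y x₀ := by
    filter_upwards [hlmax, hlmin] with t h1 h2 using le_antisymm h1 h2
  have := heq.deriv.deriv_eq
  simp at this
  exact hdd.ne' this

theorem lt_one (h : IsSolutionP y) {x : ℝ} (hx : 0 ≤ x) : y x < 1 := by
  refine (h.le_one hx).lt_of_ne fun h1 => ?_
  have hx0 : 0 < x := by
    rcases hx.eq_or_lt with rfl | hx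
    · rw [h.zero] at h1; norm_num at h1
    · exact hx
  have hlmax : IsLocalMax y x := by
    filter_upwards [Ioi_mem_nhds hx0] with t ht
    rw [h1]
    exact h.le_one (le_of_lt ht)
  have := h.isCubicSolOn.unique (isCubicSolOn_const (c := 1) (by norm_num) _) h1
    hlmax.deriv_eq_zero
  have h0 := h.zero
  rw [this] at h0
  norm_num at h0

/-- As `0 < y < 1` for positive times, `exp (-t) * y'` is strictly decreasing. Once negative, `y'`
would stay so, and `y` could not rise to 1. -/
theorem deriv_pos (h : IsSolutionP y) {x : ℝ} (hx : 0 ≤ x) : 0 < deriv y x := by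
  have hanti : StrictAntiOn (fun t => Real.exp (-t) * deriv y t) (Set.Ici 0) := by
    have hd : ∀ t, HasDerivAt (fun t => Real.exp (-t) * deriv y t)
        (Real.exp (-t) * (-(y t - y t ^ 3))) t := fun t =>
      ((hasDerivAt_neg t).exp.mul (h.isCubicSolOn t trivial).2).congr_deriv (by ring)
    refine strictAntiOn_of_hasDerivWithinAt_neg (convex_Ici 0)
      (fun t _ => (hd t).continuousAt.continuousWithinAt) (fun t _ => (hd t).hasDerivWithinAt)
      fun t ht => ?_
    rw [interior_Ici] at ht
    have h0 := h.pos t ht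
    have h1 := h.lt_one (le_of_lt ht)
    refine mul_neg_of_pos_of_neg (Real.exp_pos _) ?_
    have : 0 < y t * ((1 - y t) * (1 + y t)) :=
      mul_pos h0 (mul_pos (sub_pos.2 h1) (by linarith))
    nlinarith
  have hnonneg : ∀ t, 0 ≤ t → 0 ≤ deriv y t := by
    intro s hs
    by_contra! hcon
    have hneg : ∀ t ∈ Set.Ici s, deriv y t ≤ 0 := by
      intro t ht
      have h1 := hanti.antitoneOn hs (hs.trans ht) ht
      have h2 : Real.exp (-t) * deriv y t ≤ 0 :=
        h1.trans (mul_nonpos_of_nonneg_of_nonpos (Real.exp_pos _).le hcon.le)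
      exact nonpos_of_mul_nonpos_right h2 (Real.exp_pos _)
    have hy : AntitoneOn y (Set.Ici s) :=
      antitoneOn_of_hasDerivAt (convex_Ici s) (fun t _ => (h.differentiable t).hasDerivAt) hneg
    have : 1 ≤ y s := le_of_tendsto h.tendsto_one
      ((eventually_ge_atTop s).mono fun t ht => hy Set.self_mem_Ici ht ht)
    linarith [h.lt_one hs]
  have hx1 : (0 : ℝ) ≤ x + 1 := by linarith
  have h1 := hanti hx hx1 (lt_add_one x)
  have h2 : 0 < Real.exp (-x) * deriv y x :=
    (mul_nonneg (Real.exp_pos _).le (hnonneg _ hx1)).trans_lt h1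
  exact pos_of_mul_pos_right h2 (Real.exp_pos _).le

theorem strictMonoOn (h : IsSolutionP y) : StrictMonoOn y (Set.Ici 0) :=
  strictMonoOn_of_deriv_pos (convex_Ici 0) h.differentiable.continuous.continuousOn
    fun _ hx => h.deriv_pos (interior_subset hx)

theorem tendsto_deriv (h : IsSolutionP y) : Tendsto (deriv y) atTop (𝓝 0) :=
  (h.isCubicSolOn.mono (Set.subset_univ _)).tendsto_deriv_zero (fun _ => h.nonneg)
    (fun _ => h.le_one) (fun _ hx => (h.deriv_pos hx).le) h.tendsto_one

theorem energy_lt (h : IsSolutionP y) {x : ℝ} (hx : 0 ≤ x) :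
    deriv y x ^ 2 / 2 + y x ^ 2 / 2 - y x ^ 4 / 4 < 1 / 4 := by
  have hlim : Tendsto (fun t => deriv y t ^ 2 / 2 + y t ^ 2 / 2 - y t ^ 4 / 4) atTop
      (𝓝 (1 / 4)) := by
    have := (((h.tendsto_deriv.pow 2).div_const 2).add ((h.tendsto_one.pow 2).div_const 2)).sub
      ((h.tendsto_one.pow 4).div_const 4)
    convert this using 2
    norm_num
  have hmono := h.isCubicSolOn.monotoneOn_energy convex_univ
  have hstrict : StrictMonoOn (fun t => deriv y t ^ 2 / 2 + y t ^ 2 / 2 - y t ^ 4 / 4)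
      (Set.Icc x (x + 1)) :=
    strictMonoOn_of_hasDerivWithinAt_pos (convex_Icc _ _)
      (fun t _ => (h.isCubicSolOn.hasDerivAt_energy trivial).continuousAt.continuousWithinAt)
      (fun t _ => (h.isCubicSolOn.hasDerivAt_energy trivial).hasDerivWithinAt)
      fun t ht => pow_pos (h.deriv_pos (hx.trans (interior_subset ht).1)) 2
  have h1 := hstrict (Set.left_mem_Icc.2 (by linarith)) (Set.right_mem_Icc.2 (by linarith))
    (lt_add_one x)
  have h2 := ge_of_tendsto hlim ((eventually_ge_atTop (x + 1)).mono fun t ht =>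
    hmono (Set.mem_univ (x + 1)) (Set.mem_univ t) ht)
  exact h1.trans_le h2

/-- On the right half-line the slope of a solution is a function of its height. -/
theorem exists_slope_function (h : IsSolutionP y) :
    ∃ Ω : ℝ → ℝ, ∀ a ∈ Set.Ioo (0 : ℝ) 1, 0 < Ω a ∧ HasDerivAt Ω (1 - (a - a ^ 3) / Ω a) a ∧
      Ω a ^ 2 ≤ (1 - a ^ 2) ^ 2 / 2 ∧ ∃ x, y x = a ∧ deriv y x = Ω a := by
  have hsurj : ∀ a ∈ Set.Ioo (0 : ℝ) 1, ∃ x, 0 < x ∧ y x = a := by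
    intro a ha
    obtain ⟨M, hM0, hM⟩ := ((eventually_ge_atTop (0 : ℝ)).and
      (h.tendsto_one.eventually_const_lt ha.2)).exists
    obtain ⟨x, hx, hxa⟩ := intermediate_value_Icc hM0 h.differentiable.continuous.continuousOn
      ⟨h.zero.le.trans ha.1.le, hM.le⟩
    refine ⟨x, hx.1.lt_of_ne ?_, hxa⟩
    rintro rfl
    exact ha.1.ne (h.zero.symm.trans hxa)
  choose! ψ hψ0 hψ using hsurj
  have hmono : MonotoneOn ψ (Set.Ioo 0 1) := by
    intro a ha b hb hab
    by_contra! hlt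
    have := h.strictMonoOn (hψ0 b hb).le (hψ0 a ha).le hlt
    rw [hψ a ha, hψ b hb] at this
    exact absurd hab this.not_ge
  have himage : Set.Ioi 0 ⊆ ψ '' Set.Ioo 0 1 := by
    intro x hx
    have hmem : y x ∈ Set.Ioo (0 : ℝ) 1 := ⟨h.pos x hx, h.lt_one (le_of_lt hx)⟩
    exact ⟨y x, hmem, h.strictMonoOn.injOn (hψ0 _ hmem).le (Set.Ioi_subset_Ici_self hx) (hψ _ hmem)⟩
  refine ⟨fun a => deriv y (ψ a), fun a ha => ?_⟩
  have hpos := h.deriv_pos (hψ0 a ha).le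
  have hnhds := Ioo_mem_nhds ha.1 ha.2
  have hcont : ContinuousAt ψ a := continuousAt_of_monotoneOn_of_image_mem_nhds hmono hnhds
    (mem_of_superset (Ioi_mem_nhds (hψ0 a ha)) himage)
  have hψd : HasDerivAt ψ (deriv y (ψ a))⁻¹ a :=
    HasDerivAt.of_local_left_inverse hcont (h.differentiable _).hasDerivAt hpos.ne'
      (by filter_upwards [hnhds] with b hb using hψ b hb)
  refine ⟨hpos, ?_, ?_, ψ a, hψ a ha, rfl⟩
  · have := (h.isCubicSolOn (ψ a) trivial).2.comp a hψd
    rw [hψ a ha] at this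
    refine this.congr_deriv ?_
    field_simp
  · have := h.energy_lt (hψ0 a ha).le
    rw [hψ a ha] at this
    nlinarith

theorem unique {z : ℝ → ℝ} (hy : IsSolutionP y) (hz : IsSolutionP z) : y = z := by
  obtain ⟨Ω, hΩ⟩ := hy.exists_slope_function
  obtain ⟨Θ, hΘ⟩ := hz.exists_slope_function
  have hmono : MonotoneOn (fun a => (Ω a - Θ a) ^ 2) (Set.Ioo 0 1) := by
    refine monotoneOn_of_hasDerivAt
      (f' := fun a => 2 * (Ω a - Θ a) ^ 2 * (a - a ^ 3) / (Ω a * Θ a)) (convex_Ioo 0 1) ?_ ?_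
    · intro a ha
      obtain ⟨h1, h2, -⟩ := hΩ a ha
      obtain ⟨h3, h4, -⟩ := hΘ a ha
      refine ((h2.sub h4).pow 2).congr_deriv ?_
      simp only [Pi.sub_apply]
      field_simp
      push_cast
      ring
    · intro a ha
      have h1 := (hΩ a ha).1
      have h3 := (hΘ a ha).1
      have h5 : 0 ≤ a - a ^ 3 := by
        have : 0 ≤ a * ((1 - a) * (1 + a)) :=
          mul_nonneg ha.1.le (mul_nonneg (sub_nonneg.2 ha.2.le) (by linarith [ha.1]))
        nlinarith
      positivity
  have hlim : Tendsto (fun b : ℝ => (1 - b ^ 2) ^ 2) (𝓝[<] 1) (𝓝 0) := by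
    have : Continuous fun b : ℝ => (1 - b ^ 2) ^ 2 := by fun_prop
    simpa using (this.tendsto 1).mono_left nhdsWithin_le_nhds
  have hhalf : (1 / 2 : ℝ) ∈ Set.Ioo (0 : ℝ) 1 := by norm_num
  -- At height `b` both slopes are positive with square at most `(1 - b ^ 2) ^ 2 / 2`, so their
  -- squared difference is at most `(1 - b ^ 2) ^ 2`. Agreement at the single height `1 / 2`
  -- suffices for the ODE to match the solutions up to a shift.
  have hle : (Ω (1 / 2) - Θ (1 / 2)) ^ 2 ≤ 0 := by
    refine ge_of_tendsto hlim ?_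
    filter_upwards [Ioo_mem_nhdsLT (show (1 / 2 : ℝ) < 1 by norm_num)] with b hb
    have hb' : b ∈ Set.Ioo (0 : ℝ) 1 := ⟨by linarith [hb.1], hb.2⟩
    obtain ⟨h1, -, h2, -⟩ := hΩ b hb'
    obtain ⟨h3, -, h4, -⟩ := hΘ b hb'
    have := hmono hhalf hb' hb.1.le
    simp only at this
    nlinarith [mul_pos h1 h3]
  have heq : Ω (1 / 2) = Θ (1 / 2) := sub_eq_zero.1 (pow_eq_zero_iff two_ne_zero |>.1
    (le_antisymm hle (sq_nonneg _)))
  obtain ⟨-, -, -, p, hp, hp'⟩ := hΩ _ hhalf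
  obtain ⟨-, -, -, q, hq, hq'⟩ := hΘ _ hhalf
  have hshift : y = fun t => z (t + (q - p)) :=
    hy.isCubicSolOn.unique (hz.isCubicSolOn.comp_add_const (q - p)) (t₀ := p)
      (by rw [add_sub_cancel, hp, hq]) (by rw [add_sub_cancel, hp', hq', heq])
  -- A nonzero shift would give one of the two solutions a zero at a positive time.
  have h1 : z (q - p) = 0 := by
    have := hy.zero
    rw [hshift] at this
    simpa using this
  have h2 : y (p - q) = 0 := by rw [hshift]; simp [hz.zero]
  have h3 : q - p ≤ 0 := not_lt.1 fun hlt => (hz.pos _ hlt).ne' h1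
  have h4 : p - q ≤ 0 := not_lt.1 fun hlt => (hy.pos _ hlt).ne' h2
  have h5 : q - p = 0 := by linarith
  rw [hshift, h5]
  simp

end IsSolutionP

/-! ### Existence by shooting -/

/-- `(y, w)` solves `y' = w`, `w' = w - truncCubic a y` on the whole line. -/
def IsTruncSol (a : ℝ) (y w : ℝ → ℝ) : Prop :=
  ∀ t, HasDerivAt y (w t) t ∧ HasDerivAt w (w t - truncCubic a (y t)) t

namespace IsTruncSol

variable {a : ℝ} {y w : ℝ → ℝ}

theorem hasDerivAt_prod (h : IsTruncSol a y w) (t : ℝ) :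
    HasDerivAt (fun t => (y t, w t)) (phaseField (truncCubic a) (y t, w t)) t :=
  (h t).1.prodMk (h t).2

theorem hasDerivAt_exp_mul (h : IsTruncSol a y w) (c t : ℝ) :
    HasDerivAt (fun t => Real.exp (-t) * (w t - c)) (Real.exp (-t) * (c - truncCubic a (y t))) t :=
  ((hasDerivAt_neg t).exp.mul ((h t).2.sub_const c)).congr_deriv (by ring)

theorem antitone_exp_mul (h : IsTruncSol 0 y w) {s t : ℝ} (hst : s ≤ t) :
    Real.exp (-t) * w t ≤ Real.exp (-s) * w s := by
  have := antitoneOn_of_hasDerivAt convex_univ (fun x _ => h.hasDerivAt_exp_mul 0 x) (fun x _ => by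
    rw [zero_sub]
    exact mul_nonpos_of_nonneg_of_nonpos (Real.exp_pos _).le
      (neg_nonpos.2 (truncCubic_zero_nonneg _))) (Set.mem_univ s) (Set.mem_univ t) hst
  simpa using this

/-- Since the nonlinearity is at most `1 / 2`, the velocity never drops below 1, so even `y 2 ≥ 2`.
-/
theorem one_lt_apply_two (h : IsTruncSol 0 y w) (h0 : y 0 = 0) (hv : w 0 = 1) : 1 < y 2 := by
  have hmono := monotoneOn_of_hasDerivAt convex_univ (fun x _ => h.hasDerivAt_exp_mul (1 / 2) x)
    (fun x _ => mul_nonneg (Real.exp_pos _).le (by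
      have := abs_le.1 (abs_truncCubic_le (a := 0) (by norm_num) zero_le_one (y x))
      linarith [this.2]))
  have hw : ∀ t ∈ Set.Ici (0 : ℝ), 0 ≤ w t - 1 := by
    intro t ht
    have h1 := hmono (Set.mem_univ 0) (Set.mem_univ t) ht
    simp only [neg_zero, Real.exp_zero, hv] at h1
    have h2 : Real.exp (-t) ≤ 1 := Real.exp_le_one_iff.2 (neg_nonpos.2 ht)
    by_contra! hcon
    nlinarith [Real.exp_pos (-t)]
  have := monotoneOn_of_hasDerivAt (convex_Ici 0) (fun t _ => (h t).1.sub (hasDerivAt_id t)) hw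
    Set.self_mem_Ici (show (2 : ℝ) ∈ Set.Ici 0 by norm_num) (by norm_num)
  simp only [Pi.sub_apply, id, h0] at this
  linarith

theorem le_mul_exp (h : IsTruncSol 0 y w) (h0 : y 0 = 0) (hv : 0 ≤ w 0) {t : ℝ} (ht : 0 ≤ t) :
    y t ≤ w 0 * Real.exp t := by
  have h1 := antitoneOn_of_hasDerivAt (convex_Ici 0) (fun x _ => (h x).2.sub (h x).1)
    (fun x _ => by linarith [truncCubic_zero_nonneg (y x)])
  have h2 : AntitoneOn (fun t => Real.exp (-t) * (y t + w 0)) (Set.Ici 0) := by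
    refine antitoneOn_of_hasDerivAt (f' := fun t => Real.exp (-t) * (w t - y t - w 0))
      (convex_Ici 0) (fun x _ => ((hasDerivAt_neg x).exp.mul
        ((h x).1.add_const (w 0))).congr_deriv (by ring)) fun x hx => ?_
    have := h1 Set.self_mem_Ici hx hx
    simp only [Pi.sub_apply, h0] at this
    exact mul_nonpos_of_nonneg_of_nonpos (Real.exp_pos _).le (by linarith)
  have h3 := h2 Set.self_mem_Ici ht ht
  simp only [neg_zero, Real.exp_zero, one_mul, h0, zero_add] at h3
  have h4 : Real.exp (-t) * Real.exp t = 1 := by rw [← Real.exp_add]; simp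
  have h5 := mul_le_mul_of_nonneg_right h3 (Real.exp_pos t).le
  have h6 : Real.exp (-t) * (y t + w 0) * Real.exp t = y t + w 0 := by
    rw [mul_right_comm, h4, one_mul]
  linarith

/-- The sign of `w` changes only from plus to minus, so `y` peaks where `w = 0`. A peak above 1 is
an equilibrium of the truncated field, making the trajectory constant. -/
theorem not_neg_and_one_lt (h : IsTruncSol 0 y w) (h0 : y 0 = 0) (hv : 0 ≤ w 0) {t₁ t₂ : ℝ}
    (ht₁ : 0 ≤ t₁) (h1 : w t₁ < 0) (h2 : 1 < y t₂) : False := by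
  have hwc : Continuous w := continuous_iff_continuousAt.2 fun t => (h t).2.continuousAt
  obtain ⟨s, -, hs⟩ := intermediate_value_Icc' ht₁ hwc.continuousOn ⟨h1.le, hv⟩
  have hpos : ∀ t ∈ Set.Iic s, 0 ≤ w t := by
    intro t ht
    have := h.antitone_exp_mul ht
    rw [hs, mul_zero] at this
    exact nonneg_of_mul_nonneg_right this (Real.exp_pos _)
  have hneg : ∀ t ∈ Set.Ici s, w t ≤ 0 := by
    intro t ht
    have := h.antitone_exp_mul ht
    rw [hs, mul_zero] at this
    exact nonpos_of_mul_nonpos_right this (Real.exp_pos _)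
  have hys : y t₂ ≤ y s := by
    rcases le_total t₂ s with hle | hle
    · exact monotoneOn_of_hasDerivAt (convex_Iic s) (fun t _ => (h t).1) hpos hle
        Set.self_mem_Iic hle
    · exact antitoneOn_of_hasDerivAt (convex_Ici s) (fun t _ => (h t).1) hneg
        Set.self_mem_Ici hle hle
  have hg : truncCubic 0 (y s) = 0 := truncCubic_of_one_le zero_le_one (h2.le.trans hys)
  have := ODE_solution_unique_univ (v := fun _ => phaseField (truncCubic 0))
    (s := fun _ => Set.univ) (K := 3) (f := fun t => (y t, w t)) (g := fun _ => (y s, 0)) (t₀ := s)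
    (fun _ => (lipschitzWith_phaseField
      (lipschitzWith_truncCubic (by norm_num) zero_le_one)).lipschitzOnWith)
    (fun t => ⟨h.hasDerivAt_prod t, trivial⟩)
    (fun t => ⟨(hasDerivAt_const t _).congr_deriv (by simp [phaseField, hg, Prod.zero_eq_mk]), trivial⟩)
    (by simp only [hs])
  have h3 := congrArg Prod.fst (congrFun this 0)
  simp only [h0] at h3
  linarith

/-- Otherwise `y` vanishes on `[0, t]`, where then `w' = w`; so `w ≥ w 0 > 0` and `y` grows. -/
theorem pos_of_nonneg_deriv (h : IsTruncSol 0 y w) (h0 : y 0 = 0) (hv : 0 < w 0)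
    (hw : ∀ t, 0 ≤ t → 0 ≤ w t) {t : ℝ} (ht : 0 < t) : 0 < y t := by
  by_contra! hcon
  have hmono : MonotoneOn y (Set.Ici 0) :=
    monotoneOn_of_hasDerivAt (convex_Ici 0) (fun t _ => (h t).1) hw
  have hzero : ∀ s ∈ Set.Icc 0 t, y s = 0 := fun s hs =>
    le_antisymm ((hmono hs.1 ht.le hs.2).trans hcon)
      (h0.ge.trans (hmono Set.self_mem_Ici hs.1 hs.1))
  have hexp := monotoneOn_of_hasDerivAt (convex_Icc 0 t) (fun s _ => h.hasDerivAt_exp_mul 0 s)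
    (fun s hs => by simp [hzero s hs, truncCubic])
  have hwv : ∀ s ∈ Set.Icc 0 t, 0 ≤ w s - w 0 := by
    intro s hs
    have h1 := hexp (Set.left_mem_Icc.2 ht.le) hs hs.1
    simp only [neg_zero, Real.exp_zero, one_mul, sub_zero] at h1
    have h2 : Real.exp (-s) ≤ 1 := Real.exp_le_one_iff.2 (neg_nonpos.2 hs.1)
    nlinarith [hw s hs.1]
  have := monotoneOn_of_hasDerivAt (convex_Icc 0 t)
    (fun s _ => (h s).1.sub ((hasDerivAt_id s).const_mul (w 0)))
    (fun s hs => by simpa using hwv s hs)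
    (Set.left_mem_Icc.2 ht.le) (Set.right_mem_Icc.2 ht.le) ht.le
  simp only [Pi.sub_apply, id, h0, mul_zero, sub_zero] at this
  nlinarith [mul_pos hv ht]

theorem isCubicSolOn (h : IsTruncSol a y w) {D : Set ℝ} (hD : ∀ t ∈ D, a ≤ y t ∧ y t ≤ 1) :
    IsCubicSolOn y w D := fun t ht => by
  have := h t
  rwa [truncCubic_of_mem (hD t ht).1 (hD t ht).2] at this

/-- The starting slope is small enough that `y ≤ w 0 * exp t ≤ 1 / 2` up to time `3π/2`. Without
turning back `y` would be positive there, against Sturm comparison. -/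
theorem exists_deriv_neg (h : IsTruncSol 0 y w) (h0 : y 0 = 0)
    (hv : w 0 = Real.exp (-(3 * Real.pi / 2)) / 2) : ∃ t, 0 ≤ t ∧ w t < 0 := by
  by_contra! hw
  have hT : 0 < 3 * Real.pi / 2 := by positivity
  have hv0 : 0 < w 0 := by rw [hv]; positivity
  have hy0 : ∀ t ∈ Set.Icc 0 (0 + 3 * Real.pi / 2), 0 ≤ y t := fun t ht => by
    rcases ht.1.eq_or_lt with rfl | ht
    · exact h0.ge
    · exact (h.pos_of_nonneg_deriv h0 hv0 hw ht).le
  have hy1 : ∀ t ∈ Set.Icc 0 (0 + 3 * Real.pi / 2), y t ≤ 1 / 2 := fun t ht => by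
    refine (h.le_mul_exp h0 hv0.le ht.1).trans ?_
    rw [hv, div_mul_eq_mul_div, ← Real.exp_add]
    gcongr
    rw [Real.exp_le_one_iff]
    linarith [ht.2]
  have := (h.isCubicSolOn fun t ht => ⟨hy0 t ht, (hy1 t ht).trans (by norm_num)⟩).nonpos_of_small
    hy0 hy1
  rw [zero_add] at this
  exact absurd (h.pos_of_nonneg_deriv h0 hv0 hw hT) this.not_gt

end IsTruncSol

theorem exists_isTruncSol {a : ℝ} (ha : -1 ≤ a) (ha' : a ≤ 1) (v : ℝ) :
    ∃ y w, IsTruncSol a y w ∧ y 0 = 0 ∧ w 0 = v := by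
  obtain ⟨f, hf0, hf⟩ := exists_phaseField_solution (lipschitzWith_truncCubic ha ha')
    (fun y => (abs_truncCubic_le ha ha' y).trans (by norm_num)) v
  refine ⟨fun t => (f t).1, fun t => (f t).2, fun t => ⟨?_, ?_⟩, by simp [hf0], by simp [hf0]⟩
  · exact (hasFDerivAt_fst (𝕜 := ℝ) (p := f t)).comp_hasDerivAt t (hf t)
  · exact (hasFDerivAt_snd (𝕜 := ℝ) (p := f t)).comp_hasDerivAt t (hf t)

/-- Shooting: `A` collects the slopes that turn back and `B` those that overshoot 1. Both are open
by continuous dependence, and they are disjoint for nonnegative slopes, so they cannot cover `[v₀,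
1]`. -/
theorem exists_separatrix : ∃ y w, IsTruncSol 0 y w ∧ y 0 = 0 ∧ 0 < w 0 ∧
    ∀ t, 0 ≤ t → 0 ≤ w t ∧ y t ≤ 1 := by
  choose Y W hsol hY0 hW0 using exists_isTruncSol (a := 0) (by norm_num) zero_le_one
  have hdist : ∀ t, 0 ≤ t → ∀ u v, dist (Y u t, W u t) (Y v t, W v t) ≤
      Real.exp (3 * t) * dist u v := by
    intro t ht u v
    have := dist_le_of_trajectories_ODE (v := fun _ => phaseField (truncCubic 0)) (K := 3)
      (f := fun t => (Y u t, W u t)) (g := fun t => (Y v t, W v t)) (a := 0) (b := t)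
      (δ := dist u v)
      (fun _ => lipschitzWith_phaseField (lipschitzWith_truncCubic (by norm_num) zero_le_one))
      (fun s _ => ((hsol u).hasDerivAt_prod s).continuousAt.continuousWithinAt)
      (fun s _ => ((hsol u).hasDerivAt_prod s).hasDerivWithinAt)
      (fun s _ => ((hsol v).hasDerivAt_prod s).continuousAt.continuousWithinAt)
      (fun s _ => ((hsol v).hasDerivAt_prod s).hasDerivWithinAt)
      (by simp [hY0, hW0, Prod.dist_eq]) t (Set.right_mem_Icc.2 ht)
    rw [mul_comm]
    simpa using this
  have hcont : ∀ t, 0 ≤ t → Continuous fun v => (Y v t, W v t) := fun t ht =>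
    (LipschitzWith.of_dist_le_mul (K := ⟨Real.exp (3 * t), (Real.exp_pos _).le⟩)
      (hdist t ht)).continuous
  set A : Set ℝ := ⋃ t : Set.Ici (0 : ℝ), {v | W v t < 0} with hA
  set B : Set ℝ := ⋃ t : Set.Ici (0 : ℝ), {v | 1 < Y v t} with hB
  have hAo : IsOpen A := isOpen_iUnion fun t =>
    isOpen_lt (continuous_snd.comp (hcont t t.2)) continuous_const
  have hBo : IsOpen B := isOpen_iUnion fun t =>
    isOpen_lt continuous_const (continuous_fst.comp (hcont t t.2))
  set v₀ := Real.exp (-(3 * Real.pi / 2)) / 2 with hv₀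
  have hv₀0 : 0 < v₀ := by positivity
  have hv₀1 : v₀ ≤ 1 := by
    have : Real.exp (-(3 * Real.pi / 2)) ≤ 1 :=
      Real.exp_le_one_iff.2 (by have := Real.pi_pos; linarith)
    linarith
  have hAne : v₀ ∈ A := by
    obtain ⟨t, ht, hw⟩ := (hsol v₀).exists_deriv_neg (hY0 _) (hW0 _)
    exact Set.mem_iUnion.2 ⟨⟨t, ht⟩, hw⟩
  have hBne : (1 : ℝ) ∈ B :=
    Set.mem_iUnion.2 ⟨⟨2, by norm_num⟩, (hsol 1).one_lt_apply_two (hY0 _) (hW0 _)⟩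
  have hnot : ¬ Set.Icc v₀ 1 ⊆ A ∪ B := by
    intro hsub
    obtain ⟨v, hv, hvA, hvB⟩ := isPreconnected_Icc A B hAo hBo hsub
      ⟨v₀, Set.left_mem_Icc.2 hv₀1, hAne⟩ ⟨1, Set.right_mem_Icc.2 hv₀1, hBne⟩
    obtain ⟨t₁, h1⟩ := Set.mem_iUnion.1 hvA
    obtain ⟨t₂, h2⟩ := Set.mem_iUnion.1 hvB
    exact (hsol v).not_neg_and_one_lt (hY0 v) (by rw [hW0]; exact hv₀0.le.trans hv.1) t₁.2 h1 h2
  obtain ⟨v, hv, hvAB⟩ := Set.not_subset.1 hnot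
  refine ⟨Y v, W v, hsol v, hY0 v, by rw [hW0]; exact hv₀0.trans_le hv.1, fun t ht => ⟨?_, ?_⟩⟩
  · by_contra! hcon
    exact hvAB (Or.inl (Set.mem_iUnion.2 ⟨⟨t, ht⟩, hcon⟩))
  · by_contra! hcon
    exact hvAB (Or.inr (Set.mem_iUnion.2 ⟨⟨t, ht⟩, hcon⟩))

theorem exists_tendsto_of_monotoneOn_Ici {f : ℝ → ℝ} {a M : ℝ} (hf : MonotoneOn f (Set.Ici a))
    (hM : ∀ t, a ≤ t → f t ≤ M) : ∃ l, Tendsto f atTop (𝓝 l) := by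
  have hmono : Monotone fun t => f (max a t) := fun s t hst =>
    hf (Set.mem_Ici.2 (le_max_left _ _)) (Set.mem_Ici.2 (le_max_left _ _)) (max_le_max le_rfl hst)
  have hbdd : BddAbove (Set.range fun t => f (max a t)) :=
    ⟨M, by rintro _ ⟨t, rfl⟩; exact hM _ (le_max_left _ _)⟩
  refine ⟨_, (tendsto_atTop_ciSup hmono hbdd).congr' ?_⟩
  filter_upwards [eventually_ge_atTop a] with t ht
  rw [max_eq_right ht]

theorem exists_isSolutionP : ∃ y, IsSolutionP y := by
  obtain ⟨y, w, h, h0, hv, hyw⟩ := exists_separatrix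
  have hpos : ∀ t, 0 < t → 0 < y t := fun t ht =>
    h.pos_of_nonneg_deriv h0 hv (fun t ht => (hyw t ht).1) ht
  have hnn : ∀ t, 0 ≤ t → 0 ≤ y t := fun t ht => by
    rcases ht.eq_or_lt with rfl | ht
    · exact h0.ge
    · exact (hpos t ht).le
  have hsol : IsCubicSolOn y w (Set.Ici 0) :=
    h.isCubicSolOn fun t ht => ⟨hnn t ht, (hyw t ht).2⟩
  have hmono : MonotoneOn y (Set.Ici 0) :=
    monotoneOn_of_hasDerivAt (convex_Ici 0) (fun t _ => (h t).1) fun t ht => (hyw t ht).1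
  obtain ⟨l, hl⟩ := exists_tendsto_of_monotoneOn_Ici hmono fun t ht => (hyw t ht).2
  have hl0 : 0 < l := (hpos 1 one_pos).trans_le (ge_of_tendsto hl
    ((eventually_ge_atTop 1).mono fun t ht =>
      hmono (by norm_num) ((zero_le_one' ℝ).trans ht) ht))
  have hw : Tendsto w atTop (𝓝 0) :=
    hsol.tendsto_deriv_zero hnn (fun t ht => (hyw t ht).2) (fun t ht => (hyw t ht).1) hl
  have hl1 : l = 1 := by
    have := eq_zero_of_tendsto_deriv (fun t ht => (hsol t ht).2) hw
      (hw.sub (hl.sub (hl.pow 3)))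
    have h1 : l * ((1 - l) * (1 + l)) = 0 := by linear_combination -this
    rcases mul_eq_zero.1 h1 with h1 | h1
    · exact absurd h1 hl0.ne'
    · rcases mul_eq_zero.1 h1 with h1 | h1 <;> linarith
  rw [hl1] at hl
  have hv57 : w 0 ≤ 5 / 7 := by
    have hlim : Tendsto (fun t => w t ^ 2 / 2 + y t ^ 2 / 2 - y t ^ 4 / 4) atTop (𝓝 (1 / 4)) := by
      have := (((hw.pow 2).div_const 2).add ((hl.pow 2).div_const 2)).sub
        ((hl.pow 4).div_const 4)
      convert this using 2
      norm_num
    have := ge_of_tendsto hlim ((eventually_ge_atTop 0).mono fun t ht =>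
      hsol.monotoneOn_energy (convex_Ici 0) Set.self_mem_Ici ht ht)
    simp only [h0] at this
    nlinarith
  -- Truncating at 0 is wrong for `y < 0`, so the same data are restarted with truncation at `-1`.
  -- The new trajectory agrees with the separatrix for `t ≥ 0` and satisfies `|z| ≤ 1 / 2` for `t ≤
  -- 0`, so it solves the cubic equation everywhere.
  obtain ⟨z, u, h', hz0, hu0⟩ := exists_isTruncSol (a := -1) le_rfl (by norm_num) (w 0)
  have heq : ∀ t, 0 ≤ t → z t = y t := by
    intro t ht
    have := ODE_solution_unique (v := fun _ => phaseField (truncCubic (-1))) (K := 3)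
      (f := fun t => (z t, u t)) (g := fun t => (y t, w t)) (a := 0) (b := t)
      (fun _ => lipschitzWith_phaseField (lipschitzWith_truncCubic le_rfl (by norm_num)))
      (fun s _ => (h'.hasDerivAt_prod s).continuousAt.continuousWithinAt)
      (fun s _ => (h'.hasDerivAt_prod s).hasDerivWithinAt)
      (fun s _ => (h.hasDerivAt_prod s).continuousAt.continuousWithinAt)
      (fun s hs => by
        have h1 := (hsol.hasDerivAt_prod (t := s) hs.1).hasDerivWithinAt (s := Set.Ici s)
        rwa [phaseField, ← truncCubic_of_mem (a := -1) (by linarith [hnn s hs.1])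
          (hyw s hs.1).2] at h1)
      (by simp only [hz0, hu0, h0]) (Set.right_mem_Icc.2 ht)
    exact congrArg Prod.fst this
  have hhalf := abs_le_half_of_nonpos h' (fun x hx => by
    rw [abs_le] at hx
    exact truncCubic_of_mem (by linarith [hx.1]) (by linarith [hx.2])) hz0 (by rwa [hu0])
    (by rwa [hu0])
  have hzsol : IsCubicSolOn z u Set.univ := h'.isCubicSolOn fun t _ => by
    rcases le_total 0 t with ht | ht
    · rw [heq t ht]
      exact ⟨by linarith [hnn t ht], (hyw t ht).2⟩
    · have := abs_le.1 (hhalf t ht)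
      exact ⟨by linarith [this.1], by linarith [this.2]⟩
  have hderiv : deriv z = u := funext fun t => (hzsol t trivial).1.deriv
  refine ⟨z, fun t => (hzsol t trivial).1.differentiableAt, ?_, fun t => ?_, hz0, ?_, ?_⟩
  · rw [hderiv]
    exact fun t => (hzsol t trivial).2.differentiableAt
  · rw [hderiv, (hzsol t trivial).2.deriv]
    ring
  · exact hl.congr' ((eventually_ge_atTop 0).mono fun t ht => (heq t ht).symm)
  · intro t ht
    rw [heq t ht.le]
    exact hpos t ht

/-! ### Zeros -/

/-- Local finiteness and unboundedness below give a largest element of `Z` below any point;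
iterating this predecessor from 0 skips nothing. -/
theorem exists_strictAnti_range_eq {Z : Set ℝ} (h0 : 0 ∈ Z) (hle : ∀ z ∈ Z, z ≤ 0)
    (hfin : ∀ M, (Z ∩ Set.Ici M).Finite) (hunb : ∀ M, ∃ z ∈ Z, z < M) :
    ∃ x : ℕ → ℝ, x 0 = 0 ∧ StrictAnti x ∧ Tendsto x atTop atBot ∧ Set.range x = Z := by
  have hpred : ∀ z, ∃ p ∈ Z, p < z ∧ ∀ u ∈ Z, u < z → u ≤ p := by
    intro z
    obtain ⟨q, hq, hqz⟩ := hunb z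
    have hf : (Z ∩ Set.Ici q ∩ Set.Iio z).Finite := (hfin q).inter_of_left _
    obtain ⟨p, ⟨⟨hpZ, hqp⟩, hpz⟩, hp⟩ := hf.exists_maximal ⟨q, ⟨hq, Set.self_mem_Ici⟩, hqz⟩
    refine ⟨p, hpZ, hpz, fun u hu huz => ?_⟩
    by_contra! hlt
    exact absurd (hp ⟨⟨hu, hqp.trans hlt.le⟩, huz⟩ hlt.le) hlt.not_ge
  choose p hpZ hplt hpmax using hpred
  set x : ℕ → ℝ := fun n => p^[n] 0 with hx
  have hsucc : ∀ n, x (n + 1) = p (x n) := fun n => Function.iterate_succ_apply' p n 0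
  have hxZ : ∀ n, x n ∈ Z := by
    intro n
    cases n with
    | zero => exact h0
    | succ n => rw [hsucc]; exact hpZ _
  have hanti : StrictAnti x := strictAnti_nat_of_succ_lt fun n => by
    rw [hsucc]; exact hplt _
  have hlim : Tendsto x atTop atBot := by
    refine tendsto_atTop_atBot_of_antitone hanti.antitone fun M => ?_
    by_contra! hM
    exact Set.infinite_range_of_injective hanti.injective ((hfin M).subset (by
      rintro _ ⟨n, rfl⟩
      exact ⟨hxZ n, (hM n).le⟩))
  refine ⟨x, rfl, hanti, hlim, Set.Subset.antisymm (by rintro _ ⟨n, rfl⟩; exact hxZ n) ?_⟩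
  intro z hz
  by_contra hzr
  have hlt : ∀ n, z < x n := by
    intro n
    induction n with
    | zero => exact (hle z hz).lt_of_ne fun he => hzr ⟨0, he.symm⟩
    | succ n ih =>
      refine lt_of_le_of_ne ?_ fun he => hzr ⟨n + 1, he.symm⟩
      rw [hsucc]
      exact hpmax _ z hz ih
  obtain ⟨n, hn⟩ := (hlim.eventually_le_atBot z).exists
  exact absurd (hlt n) hn.not_gt

/-- At an accumulation point of zeros both `y` and `w` vanish, so uniqueness makes `y` identically
zero. -/
theorem IsCubicSolOn.finite_zeros {y w : ℝ → ℝ} (h : IsCubicSolOn y w Set.univ)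
    (hne : y ≠ fun _ => 0) {K : Set ℝ} (hK : IsCompact K) : ({t | y t = 0} ∩ K).Finite := by
  by_contra hinf
  obtain ⟨z, -, hz⟩ := Set.Infinite.exists_accPt_of_subset_isCompact hinf hK
    Set.inter_subset_right
  have hfreq := accPt_iff_frequently_nhdsNE.1 hz
  refine hfreq ?_
  have hev : ∀ᶠ t in 𝓝[≠] z, y t ≠ 0 := by
    by_cases hyz : y z = 0
    · refine (h z trivial).1.eventually_ne fun hwz => hne ?_
      exact h.unique (isCubicSolOn_const (by norm_num) _) hyz hwz
    · exact (h.continuous.continuousAt.eventually_ne hyz).filter_mono nhdsWithin_le_nhds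
  exact hev.mono fun t ht hmem => ht hmem.1

theorem IsSolutionP.abs_le_half {y : ℝ → ℝ} (h : IsSolutionP y) : ∀ t ≤ 0, |y t| ≤ 1 / 2 := by
  refine abs_le_half_of_nonpos (g := fun x => x - x ^ 3) (fun t => h.isCubicSolOn t trivial)
    (fun _ _ => rfl) h.zero (h.deriv_pos le_rfl) ?_
  have := h.energy_lt le_rfl
  rw [h.zero] at this
  nlinarith

theorem IsSolutionP.exists_zeros {y : ℝ → ℝ} (h : IsSolutionP y) :
    ∃ x : ℕ → ℝ, x 0 = 0 ∧ StrictAnti x ∧ Tendsto x atTop atBot ∧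
      Set.range x = {t : ℝ | y t = 0} := by
  have hle : ∀ z ∈ {t : ℝ | y t = 0}, z ≤ 0 := fun z hz =>
    not_lt.1 fun hlt => (h.pos z hlt).ne' hz
  refine exists_strictAnti_range_eq h.zero hle (fun M => ?_) fun M => ?_
  · have hne : y ≠ fun _ => 0 := fun he => by
      have := h.pos 1 one_pos
      rw [he] at this
      exact lt_irrefl _ this
    exact (h.isCubicSolOn.finite_zeros hne (isCompact_Icc (a := M) (b := 0))).subset
      fun z hz => ⟨hz.1, hz.2, hle z hz.1⟩
  -- The window of length `3π/2` ends at `min M 0 - 1`, hence lies below `M` and in the region where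
  -- `|y| ≤ 1 / 2`.
  · obtain ⟨t, ht, hyt⟩ := h.isCubicSolOn.exists_zero_of_small
      (a := min M 0 - 1 - 3 * Real.pi / 2) fun t ht => h.abs_le_half t (by
        linarith [ht.2, min_le_right M 0])
    exact ⟨t, hyt, by linarith [ht.2, min_le_left M 0]⟩

theorem theorem2 :
    (∃! y : ℝ → ℝ, IsSolutionP y) ∧
      ∀ y : ℝ → ℝ, IsSolutionP y →
        (∃ x : ℕ → ℝ, x 0 = 0 ∧ StrictAnti x ∧ Tendsto x atTop atBot ∧
            Set.range x = {t : ℝ | y t = 0}) ∧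
          Tendsto y atBot (𝓝 0) ∧
          ∀ t : ℝ, t ≤ 0 → |y t| ≤ 1 / 2 := by
  obtain ⟨y, hy⟩ := exists_isSolutionP
  exact ⟨⟨y, hy, fun _ hz => hz.unique hy⟩, fun y hy =>
    ⟨hy.exists_zeros, hy.isCubicSolOn.tendsto_zero_atBot hy.abs_le_half, hy.abs_le_half⟩⟩
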